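/- Let $d\ge 1$, let $T\subset\mathbb{R}^d$ be a (closed, nondegenerate) $d$-dimensional simplex, and let $F$ be one of its $(d-1)$-dimensional faces. For an integer $m\ge 0$ let $\mathbb{P}_m(T)$ be the space of real polynomials on $T$ of total degree at most $m$, and let $\Pi_T^m$ be the $L^2(T)$-orthogonal projection onto $\mathbb{P}_m(T)$; put $\Pi_T^{-1}\xi:=0$. Let $p\ge 0$ and $n$ be integers with $-1\le n\le p$. Then for every $\xi\in\mathbb{P}_p(T)$ the polynomial $\theta:=\xi-\Pi_T^n\xi$ satisfies $$\|\theta\|_{L^2(F)}^2\;\le\;\frac{(p-n)(p+n+1+d)}{d}\,\frac{|F|}{|T|}\,\|\theta\|_{L^2(T)}^2 .$$ Here $|T|$ and $\|\cdot\|_{L^2(T)}$ refer to Lebesgue measure on $\mathbb{R}^d$, and $|F|$ and $\|\cdot\|_{L^2(F)}$ to the $(d-1)$-dimensional surface measure (the counting measure if $d=1$, so that then $|F|=1$). -/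

import Mathlib

open MeasureTheory

namespace InverseTrace

/-- The space `ℙ_n` of real polynomials in `d` variables of total degree at most `n`. A polynomial
is identified with the function it defines on a `d`-simplex of `ℝ^d`; this loses nothing, since such
a simplex has nonempty interior. -/
noncomputable abbrev Poly (d n : ℕ) : Submodule ℝ (MvPolynomial (Fin d) ℝ) :=
  MvPolynomial.restrictTotalDegree (Fin d) ℝ n

/-- The value of a polynomial at a point of `ℝ^d`. -/
noncomputable def val {d : ℕ} (q : MvPolynomial (Fin d) ℝ) (x : EuclideanSpace ℝ (Fin d)) : ℝ :=
  MvPolynomial.eval (fun i => x i) q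

/-- The squared norm `‖q‖²` in `L²(S, μ)`. -/
noncomputable def normSq {d : ℕ} (μ : Measure (EuclideanSpace ℝ (Fin d)))
    (S : Set (EuclideanSpace ℝ (Fin d))) (q : MvPolynomial (Fin d) ℝ) : ℝ :=
  ∫ x in S, (val q x) ^ 2 ∂μ

/-- `π` is the `L²(T)`-orthogonal projection of `ξ` onto `ℙ_n`: it lies in `ℙ_n`, and `ξ - π` is
orthogonal to `ℙ_n` in `L²(T)`. -/
def IsL2Proj {d : ℕ} (T : Affine.Simplex ℝ (EuclideanSpace ℝ (Fin d)) d) (n : ℕ)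
    (ξ π : MvPolynomial (Fin d) ℝ) : Prop :=
  π ∈ Poly d n ∧ ∀ q ∈ Poly d n, ∫ x in T.closedInterior, val (ξ - π) x * val q x = 0

theorem continuous_val {d : ℕ} (q : MvPolynomial (Fin d) ℝ) : Continuous (val q) := by
  unfold val
  exact (MvPolynomial.continuous_eval q).comp (by fun_prop)

theorem isCompact_simplex {d : ℕ} (T : Affine.Simplex ℝ (EuclideanSpace ℝ (Fin d)) d) :
    IsCompact T.closedInterior := by
  rw [← Affine.Simplex.convexHull_eq_closedInterior]
  exact (Set.finite_range T.points).isCompact_convexHull (𝕜 := ℝ)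

theorem integrableOn_val_mul {d : ℕ} (T : Affine.Simplex ℝ (EuclideanSpace ℝ (Fin d)) d)
    (q r : MvPolynomial (Fin d) ℝ) :
    IntegrableOn (fun x => val q x * val r x) T.closedInterior :=
  ((continuous_val q).mul (continuous_val r)).continuousOn.integrableOn_compact
    (isCompact_simplex T)

theorem interior_nonempty {d : ℕ} (T : Affine.Simplex ℝ (EuclideanSpace ℝ (Fin d)) d) :
    (interior T.closedInterior).Nonempty := by
  rw [← Affine.Simplex.convexHull_eq_closedInterior,
    interior_convexHull_nonempty_iff_affineSpan_eq_top]
  exact T.independent.affineSpan_eq_top_iff_card_eq_finrank_add_one.2 (by simp)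

/-- The `L²(T)` form is positive definite on polynomials. -/
theorem eq_zero_of_integral_sq {d : ℕ} (T : Affine.Simplex ℝ (EuclideanSpace ℝ (Fin d)) d)
    (q : MvPolynomial (Fin d) ℝ) (h : ∫ x in T.closedInterior, val q x * val q x = 0) :
    q = 0 := by
  rw [setIntegral_eq_zero_iff_of_nonneg_ae (Filter.Eventually.of_forall fun x => mul_self_nonneg _)
    (integrableOn_val_mul T q q)] at h
  have h1 : val q =ᵐ[volume.restrict (interior T.closedInterior)] fun _ => (0 : ℝ) := by
    have := ae_restrict_of_ae_restrict_of_subset interior_subset h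
    filter_upwards [this] with x hx using by simpa using hx
  have h2 := Measure.eqOn_open_of_ae_eq h1 isOpen_interior
    (continuous_val q).continuousOn continuousOn_const
  obtain ⟨x₀, hx₀⟩ := interior_nonempty T
  have han : AnalyticOnNhd ℝ (fun y : Fin d → ℝ => MvPolynomial.eval y q) Set.univ :=
    AnalyticOnNhd.eval_mvPolynomial q
  have hev : (fun y : Fin d → ℝ => MvPolynomial.eval y q) =ᶠ[nhds (fun i => x₀ i)] 0 := by
    have hc : Continuous (fun y : Fin d → ℝ => (WithLp.toLp 2 y : EuclideanSpace ℝ (Fin d))) := by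
      fun_prop
    have := hc.continuousAt.preimage_mem_nhds (x := fun i => x₀ i)
      (isOpen_interior.mem_nhds hx₀)
    filter_upwards [this] with y hy using h2 hy
  have hz := han.eq_of_eventuallyEq (fun _ _ => analyticAt_const) hev
  apply MvPolynomial.funext
  intro y
  rw [map_zero]
  exact congrFun hz y

/-- The `L²(T)` inner product as a bilinear form on polynomials. -/
noncomputable def l2Form {d : ℕ} (T : Affine.Simplex ℝ (EuclideanSpace ℝ (Fin d)) d) :
    MvPolynomial (Fin d) ℝ →ₗ[ℝ] MvPolynomial (Fin d) ℝ →ₗ[ℝ] ℝ :=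
  LinearMap.mk₂ ℝ (fun q r => ∫ x in T.closedInterior, val q x * val r x)
    (fun q₁ q₂ r => by
      rw [← integral_add (integrableOn_val_mul T q₁ r) (integrableOn_val_mul T q₂ r)]
      simp [val, add_mul])
    (fun c q r => by
      simp only [smul_eq_mul]
      rw [← integral_const_mul]
      simp [val, mul_assoc])
    (fun q r₁ r₂ => by
      rw [← integral_add (integrableOn_val_mul T q r₁) (integrableOn_val_mul T q r₂)]
      simp [val, mul_add])
    (fun c q r => by
      simp only [smul_eq_mul]
      rw [← integral_const_mul]
      simp [val, mul_left_comm])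

theorem existsUnique_isL2Proj {d : ℕ} (T : Affine.Simplex ℝ (EuclideanSpace ℝ (Fin d)) d) (n : ℕ)
    (ξ : MvPolynomial (Fin d) ℝ) : ∃! π, IsL2Proj T n ξ π := by
  let A : Poly d n →ₗ[ℝ] Module.Dual ℝ (Poly d n) :=
    (l2Form T).domRestrict₁₂ (Poly d n) (Poly d n)
  have hA : Function.Injective A := by
    rw [injective_iff_map_eq_zero]
    intro q hq
    have := LinearMap.congr_fun hq q
    exact Subtype.ext (eq_zero_of_integral_sq T q this)
  have hS : Function.Surjective A :=
    (LinearMap.injective_iff_surjective_of_finrank_eq_finrank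
      Subspace.dual_finrank_eq.symm).1 hA
  obtain ⟨π, hπ⟩ := hS ((l2Form T ξ).domRestrict (Poly d n))
  refine ⟨π, ⟨π.2, fun q hq => ?_⟩, fun π' h' => ?_⟩
  · have h := LinearMap.congr_fun hπ ⟨q, hq⟩
    have h : l2Form T π q = l2Form T ξ q := h
    change l2Form T (ξ - π) q = 0
    simp [h]
  · have h1 : A ⟨π', h'.1⟩ = A π := by
      rw [hπ]
      ext q
      have h2 : l2Form T (ξ - π') q = 0 := h'.2 q q.2
      change l2Form T π' q = l2Form T ξ q
      rw [map_sub, LinearMap.sub_apply, sub_eq_zero] at h2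
      exact h2.symm
    exact congrArg Subtype.val (hA h1)

/-- The `L²(T)`-orthogonal projection of the polynomial `ξ` onto `ℙ_n`, `n ≥ 0`. -/
noncomputable def l2Proj {d : ℕ} (T : Affine.Simplex ℝ (EuclideanSpace ℝ (Fin d)) d) (n : ℕ)
    (ξ : MvPolynomial (Fin d) ℝ) : MvPolynomial (Fin d) ℝ :=
  (existsUnique_isL2Proj T n ξ).choose

theorem isL2Proj_l2Proj {d : ℕ} (T : Affine.Simplex ℝ (EuclideanSpace ℝ (Fin d)) d) (n : ℕ)
    (ξ : MvPolynomial (Fin d) ℝ) : IsL2Proj T n ξ (l2Proj T n ξ) :=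
  (existsUnique_isL2Proj T n ξ).choose_spec.1

/-- `Π_T^n` for an integer index: the `L²(T)`-orthogonal projection onto `ℙ_n` if `n ≥ 0`, and `0`
if `n` is negative (only `n = -1` is used). -/
noncomputable def projT {d : ℕ} (T : Affine.Simplex ℝ (EuclideanSpace ℝ (Fin d)) d) :
    ℤ → MvPolynomial (Fin d) ℝ → MvPolynomial (Fin d) ℝ
  | Int.ofNat n, ξ => l2Proj T n ξ
  | Int.negSucc _, _ => 0

section Cone

variable {E : Type*} [NormedAddCommGroup E] [InnerProductSpace ℝ E]

/-- The cone with apex `v` over the base `{v + ν + w | w ∈ K}`. -/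
def cone {W : Submodule ℝ E} (v ν : E) (K : Set W) : Set E :=
  (fun q : ℝ × W => v + q.1 • (ν + q.2)) '' (Set.Icc 0 1 ×ˢ K)

theorem isCompact_cone {W : Submodule ℝ E} (v ν : E) {K : Set W} (hK : IsCompact K) :
    IsCompact (cone v ν K) :=
  (isCompact_Icc.prod hK).image (by fun_prop)

theorem mem_cone_iff {W : Submodule ℝ E} {v ν : E} (hν : ν ∈ Wᗮ) (hν0 : ν ≠ 0) {K : Set W}
    {t : ℝ} {w : W} :
    v + t • ν + w ∈ cone v ν K ↔ t ∈ Set.Icc (0 : ℝ) 1 ∧ ∃ y ∈ K, w = t • y := by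
  constructor
  · rintro ⟨⟨s, y⟩, ⟨hs, hy⟩, h⟩
    simp only at h
    have h1 : (s • y - w : E) = (t - s) • ν := by
      rw [smul_add, add_assoc, add_right_inj] at h
      rw [sub_smul, sub_eq_sub_iff_add_eq_add, add_comm, h]
    have h2 : (s • y - w : E) = 0 := by
      have hm : (s • y - w : E) ∈ W := W.sub_mem (W.smul_mem _ y.2) w.2
      have hm' : (s • y - w : E) ∈ Wᗮ := h1 ▸ Wᗮ.smul_mem _ hν
      exact inner_self_eq_zero.1 (hm' _ hm)
    have h3 : t = s := by
      rw [h2] at h1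
      rcases smul_eq_zero.1 h1.symm with h | h
      · linarith
      · exact absurd h hν0
    subst h3
    exact ⟨hs, y, hy, Subtype.ext (sub_eq_zero.1 h2).symm⟩
  · rintro ⟨ht, y, hy, rfl⟩
    exact ⟨(t, y), ⟨ht, hy⟩, by simp [smul_add, add_assoc]⟩

variable [FiniteDimensional ℝ E] [MeasurableSpace E] [BorelSpace E]

/-- Fubini's theorem in the coordinates `(w, t) ↦ v + t ν + w`, where `ν` spans `Wᗮ`. -/
theorem integral_eq_integral_prod_orthogonal (W : Submodule ℝ E) (hW : Module.finrank ℝ Wᗮ = 1)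
    {ν : E} (hν : ν ∈ Wᗮ) (hν0 : ν ≠ 0) (v : E) {G : E → ℝ} (hG : Integrable G) :
    ∫ x, G x = ‖ν‖ * ∫ t : ℝ, ∫ w : W, G (v + t • ν + w) := by
  have hmp : MeasurePreserving (W.measurableEquivProd v) volume volume := by
    have h := W.measurePreserving_measurableEquivProd v
    rwa [InnerProductSpace.euclideanHausdorffMeasure_eq_volume] at h
  set ν' : Wᗮ := ⟨ν, hν⟩
  have hν' : ν' ≠ 0 := fun h => hν0 (congrArg Subtype.val h)
  have hvol : (volume : Measure Wᗮ) = ‖ν'‖ₑ • volume.map (fun t : ℝ => t • ν') :=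
    volume_eq_of_finrank_eq_one hW hν'
  have hemb : MeasurableEmbedding (fun t : ℝ => t • ν') :=
    (isClosedEmbedding_smul_left hν').measurableEmbedding
  have hG' : Integrable (fun q => G ((W.measurableEquivProd v).symm q)) (volume.prod volume) :=
    (hmp.symm).integrable_comp_of_integrable hG
  rw [← hmp.symm.integral_comp (MeasurableEquiv.measurableEmbedding _) G, Measure.volume_eq_prod,
    integral_prod_symm _ hG', hvol, integral_smul_measure, hemb.integral_map]
  simp only [toReal_enorm, smul_eq_mul, Submodule.measurableEquivProd_symm_apply]
  congr 1
  refine integral_congr_ae (.of_forall fun t => ?_)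
  refine integral_congr_ae (.of_forall fun w => ?_)
  simp only [vadd_eq_add, Submodule.coe_smul, ν']
  congr 1
  abel

/-- Integration over a cone in coordinates adapted to its apex. -/
theorem setIntegral_cone (W : Submodule ℝ E) (hW : Module.finrank ℝ Wᗮ = 1)
    {ν : E} (hν : ν ∈ Wᗮ) (hν0 : ν ≠ 0) (v : E) {K : Set W} (hK : IsCompact K) {g : E → ℝ}
    (hg : Continuous g) :
    ∫ x in cone v ν K, g x =
      ‖ν‖ * ∫ w in K, ∫ t in (0 : ℝ)..1, t ^ Module.finrank ℝ W * g (v + t • (ν + w)) := by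
  have hT := isCompact_cone v ν hK
  have hint : Integrable ((cone v ν K).indicator g) :=
    (hg.continuousOn.integrableOn_compact hT).integrable_indicator hT.measurableSet
  rw [← integral_indicator hT.measurableSet,
    integral_eq_integral_prod_orthogonal W hW hν hν0 v hint]
  congr 1
  have hslice : ∀ t : ℝ, t ≠ 0 → ∫ w : W, (cone v ν K).indicator g (v + t • ν + w) =
      (Set.Ioc (0 : ℝ) 1).indicator
        (fun t => ∫ w in K, t ^ Module.finrank ℝ W * g (v + t • (ν + w))) t := by
    intro t ht
    by_cases ht1 : t ∈ Set.Ioc (0 : ℝ) 1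
    · rw [Set.indicator_of_mem ht1]
      have ht0 : 0 < t := ht1.1
      have h := Measure.integral_comp_smul (volume : Measure W)
        (fun w : W => (cone v ν K).indicator g (v + t • ν + w)) t
      rw [abs_of_pos (by positivity), smul_eq_mul, eq_inv_mul_iff_mul_eq₀ (by positivity)] at h
      rw [← h, integral_const_mul, ← integral_indicator hK.measurableSet]
      congr 1
      refine integral_congr_ae (.of_forall fun w => ?_)
      have hmem : v + t • ν + ((t • w : W) : E) ∈ cone v ν K ↔ w ∈ K := by
        rw [mem_cone_iff hν hν0]
        constructor
        · rintro ⟨-, y, hy, h⟩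
          rwa [smul_right_injective _ ht h]
        · exact fun hw => ⟨⟨ht0.le, ht1.2⟩, w, hw, rfl⟩
      by_cases hw : w ∈ K
      · simp only [Set.indicator_of_mem (hmem.2 hw), Set.indicator_of_mem hw]
        simp [smul_add, add_assoc]
      · simp only [Set.indicator_of_notMem (mt hmem.1 hw), Set.indicator_of_notMem hw]
    · rw [Set.indicator_of_notMem ht1]
      refine integral_eq_zero_of_ae (.of_forall fun w => Set.indicator_of_notMem ?_ _)
      rw [mem_cone_iff hν hν0]
      rintro ⟨h, -⟩
      exact ht1 ⟨lt_of_le_of_ne h.1 ht.symm, h.2⟩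
  have hae : ∀ᵐ t : ℝ, t ≠ 0 := by
    rw [ae_iff]; simp
  rw [integral_congr_ae (hae.mono hslice), integral_indicator measurableSet_Ioc]
  simp_rw [intervalIntegral.integral_of_le (zero_le_one' ℝ)]
  apply integral_integral_swap
  rw [Measure.prod_restrict]
  have hc : Continuous (Function.uncurry fun (t : ℝ) (w : W) =>
      t ^ Module.finrank ℝ W * g (v + t • (ν + w))) := by
    unfold Function.uncurry
    fun_prop
  exact (hc.continuousOn.integrableOn_compact (isCompact_Icc.prod hK)).mono_set
    (Set.prod_mono Set.Ioc_subset_Icc_self subset_rfl)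

end Cone

section Euler

variable {d : ℕ}

/-- The derivation `q ↦ (x - v) · ∇q`. -/
noncomputable def radial (v : EuclideanSpace ℝ (Fin d)) :
    Derivation ℝ (MvPolynomial (Fin d) ℝ) (MvPolynomial (Fin d) ℝ) :=
  ∑ i, (MvPolynomial.X i - MvPolynomial.C (v i)) • MvPolynomial.pderiv i

theorem radial_apply (v : EuclideanSpace ℝ (Fin d)) (q : MvPolynomial (Fin d) ℝ) :
    radial v q = ∑ i, (MvPolynomial.X i - MvPolynomial.C (v i)) * MvPolynomial.pderiv i q := by
  have h := congrFun (map_sum (Derivation.coeFnAddMonoidHom (R := ℝ) (A := MvPolynomial (Fin d) ℝ)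
    (M := MvPolynomial (Fin d) ℝ))
    (fun i => (MvPolynomial.X i - MvPolynomial.C (v i)) • MvPolynomial.pderiv i) Finset.univ) q
  rw [Finset.sum_apply] at h
  exact h

/-- The chain rule along rays issuing from `v`. -/
theorem hasDerivAt_val_ray (v u : EuclideanSpace ℝ (Fin d)) (q : MvPolynomial (Fin d) ℝ) (t : ℝ) :
    HasDerivAt (fun s : ℝ => val q (v + s • u))
      (∑ i, u i * val (MvPolynomial.pderiv i q) (v + t • u)) t := by
  induction q using MvPolynomial.induction_on with
  | C a => simpa [val] using hasDerivAt_const t a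
  | add p q hp hq =>
    convert! hp.add hq using 1
    · ext s; simp [val]
    · rw [← Finset.sum_add_distrib]
      exact Finset.sum_congr rfl fun i _ => by simp [val, mul_add]
  | mul_X p j hp =>
    have hX : HasDerivAt (fun s : ℝ => v j + s * u j) (u j) t := by
      simpa using ((hasDerivAt_id t).mul_const (u j)).const_add (v j)
    convert! hp.mul hX using 1
    · ext s; simp [val]
    · simp only [val, Derivation.leibniz, smul_eq_mul, map_add, map_mul, MvPolynomial.eval_X,
        MvPolynomial.pderiv_X, mul_add (u _), Finset.sum_add_distrib, Finset.sum_mul]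
      rw [add_comm]
      congr 1
      · refine Finset.sum_congr rfl fun i _ => ?_
        simp
        ring
      · rw [Finset.sum_eq_single j]
        · simp; ring
        · intro i _ hi
          simp [hi.symm]
        · simp

theorem val_radial_ray (v u : EuclideanSpace ℝ (Fin d)) (q : MvPolynomial (Fin d) ℝ) (t : ℝ) :
    val (radial v q) (v + t • u) =
      t * ∑ i, u i * val (MvPolynomial.pderiv i q) (v + t • u) := by
  simp [val, radial_apply, Finset.mul_sum, mul_assoc]

theorem integral_val_ray (v u : EuclideanSpace ℝ (Fin d)) (q : MvPolynomial (Fin d) ℝ) (k : ℕ) :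
    ∫ t in (0 : ℝ)..1, t ^ k * val ((k + 1 : ℝ) • q + radial v q) (v + t • u) = val q (v + u) := by
  have hd : ∀ t : ℝ, HasDerivAt (fun s : ℝ => s ^ (k + 1) * val q (v + s • u))
      (t ^ k * val ((k + 1 : ℝ) • q + radial v q) (v + t • u)) t := by
    intro t
    convert! (hasDerivAt_pow (k + 1) t).mul (hasDerivAt_val_ray v u q t) using 1
    have : val ((k + 1 : ℝ) • q + radial v q) (v + t • u) =
        (k + 1) * val q (v + t • u) + val (radial v q) (v + t • u) := by simp [val]
    rw [this, val_radial_ray]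
    push_cast
    ring
  rw [intervalIntegral.integral_eq_sub_of_hasDerivAt (fun t _ => hd t)]
  · simp
  · refine Continuous.intervalIntegrable ?_ _ _
    exact (continuous_pow k).mul ((continuous_val _).comp (by fun_prop))

/-- Polynomials of total degree less than `n`. -/
noncomputable def polyLT (d n : ℕ) : Submodule ℝ (MvPolynomial (Fin d) ℝ) :=
  MvPolynomial.restrictSupport ℝ {s | s.degree < n}

theorem polyLT_succ (n : ℕ) : polyLT d (n + 1) = Poly d n := by
  simp only [polyLT, Nat.lt_succ_iff]
  rfl

theorem polyLT_zero : polyLT d 0 = ⊥ := by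
  simp [polyLT, MvPolynomial.restrictSupport_eq_span]

theorem polyLT_mono {m n : ℕ} (h : m ≤ n) : polyLT d m ≤ polyLT d n :=
  MvPolynomial.restrictSupport_mono _ fun _ hs => lt_of_lt_of_le hs h

/-- Euler's identity up to terms of lower degree. -/
theorem radial_sub_smul_mem (v : EuclideanSpace ℝ (Fin d)) {m : ℕ} {q : MvPolynomial (Fin d) ℝ}
    (hq : q ∈ polyLT d (m + 1)) : radial v q - (m : ℝ) • q ∈ polyLT d m := by
  rw [polyLT, MvPolynomial.restrictSupport_eq_span] at hq
  induction hq using Submodule.span_induction with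
  | zero => simp
  | add p q _ _ hp hq =>
    rw [map_add, smul_add, add_sub_add_comm]
    exact Submodule.add_mem _ hp hq
  | smul c p _ hp =>
    rw [Derivation.map_smul, smul_comm, ← smul_sub]
    exact Submodule.smul_mem _ _ hp
  | mem q h =>
    obtain ⟨s, hs, rfl⟩ := h
    have hs : s.degree < m + 1 := hs
    have hE := (MvPolynomial.isHomogeneous_monomial (σ := Fin d) (1 : ℝ)
      (rfl : s.degree = s.degree)).sum_X_mul_pderiv
    rw [radial_apply]
    simp only [sub_mul, Finset.sum_sub_distrib]
    rw [hE, sub_right_comm]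
    refine Submodule.sub_mem _ ?_ (Submodule.sum_mem _ fun i _ => ?_)
    · rcases Nat.lt_succ_iff_lt_or_eq.1 hs with h | h
      · refine Submodule.sub_mem _ (Submodule.smul_of_tower_mem _ _ ?_)
          (Submodule.smul_mem _ _ ?_) <;>
        exact (MvPolynomial.monomial_mem_restrictSupport ℝ).2 (Or.inl h)
      · rw [h, Nat.cast_smul_eq_nsmul, sub_self]
        exact Submodule.zero_mem _
    · rw [← MvPolynomial.smul_eq_C_mul, MvPolynomial.pderiv_monomial]
      refine Submodule.smul_mem _ _ ((MvPolynomial.monomial_mem_restrictSupport ℝ).2 ?_)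
      rcases Nat.eq_zero_or_pos (s i) with h | h
      · exact Or.inr (by simp [h])
      · left
        have hle : Finsupp.single i 1 ≤ s := Finsupp.single_le_iff.2 h
        have h1 := congrArg Finsupp.degree (tsub_add_cancel_of_le hle)
        rw [map_add, Finsupp.degree_single] at h1
        change Finsupp.degree _ < m
        omega

end Euler

section Geometry

variable {d : ℕ} [NeZero d] (T : Affine.Simplex ℝ (EuclideanSpace ℝ (Fin d)) d) (i : Fin (d + 1))

/-- The direction of the facet opposite to the vertex `i`. -/
noncomputable def facetDir : Submodule ℝ (EuclideanSpace ℝ (Fin d)) :=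
  vectorSpan ℝ (Set.range (T.faceOpposite i).points)

/-- The vector from the vertex `i` to the foot of its altitude. -/
noncomputable def altitudeVec : EuclideanSpace ℝ (Fin d) :=
  T.altitudeFoot i - T.points i

/-- The facet opposite to the vertex `i`, as a subset of its direction. -/
def facetSet : Set (facetDir T i) :=
  (fun w : facetDir T i => T.points i + altitudeVec T i + w) ⁻¹' (T.faceOpposite i).closedInterior

theorem finrank_facetDir : Module.finrank ℝ (facetDir T i) = d - 1 :=
  (T.faceOpposite i).independent.finrank_vectorSpan (by simp)

theorem finrank_facetDir_orthogonal : Module.finrank ℝ (facetDir T i)ᗮ = 1 := by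
  have h := (facetDir T i).finrank_add_finrank_orthogonal
  rw [finrank_facetDir, finrank_euclideanSpace, Fintype.card_fin] at h
  have := NeZero.pos d
  omega

theorem altitudeVec_ne_zero : altitudeVec T i ≠ 0 :=
  sub_ne_zero.2 (T.ne_altitudeFoot i).symm

theorem altitudeVec_mem_orthogonal : altitudeVec T i ∈ (facetDir T i)ᗮ := by
  have h := EuclideanGeometry.orthogonalProjection_vsub_mem_direction_orthogonal
    (affineSpan ℝ (Set.range (T.faceOpposite i).points)) (T.points i)
  exact Submodule.orthogonal_le (direction_affineSpan ℝ _).ge h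

theorem isometry_facetMap :
    Isometry (fun w : facetDir T i =>
      T.points i + altitudeVec T i + (w : EuclideanSpace ℝ (Fin d))) :=
  (isometry_add_left _).comp isometry_subtype_coe

theorem isCompact_facetSet : IsCompact (facetSet T i) :=
  (isometry_facetMap T i).isClosedEmbedding.isCompact_preimage
    (T.faceOpposite i).isCompact_closedInterior

theorem sub_mem_facetDir {y : EuclideanSpace ℝ (Fin d)}
    (hy : y ∈ (T.faceOpposite i).closedInterior) :
    y - (T.points i + altitudeVec T i) ∈ facetDir T i := by
  have h := AffineSubspace.vsub_mem_direction
    ((T.faceOpposite i).closedInterior_subset_affineSpan hy)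
    (T.altitudeFoot_mem_affineSpan_faceOpposite i)
  rw [direction_affineSpan] at h
  rwa [altitudeVec, add_sub_cancel]

theorem closedInterior_eq_cone :
    T.closedInterior = cone (T.points i) (altitudeVec T i) (facetSet T i) := by
  have hr : Set.range T.points = insert (T.points i) (Set.range (T.faceOpposite i).points) := by
    rw [Affine.Simplex.range_faceOpposite_points, ← Set.image_insert_eq, ← Set.image_univ]
    congr 1
    ext j
    simp [em]
  rw [← Affine.Simplex.convexHull_eq_closedInterior, hr,
    convexHull_insert (Set.range_nonempty _), Affine.Simplex.convexHull_eq_closedInterior]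
  ext x
  simp only [convexJoin_singleton_left, Set.mem_iUnion, exists_prop, segment_eq_image_lineMap,
    Set.mem_image, cone, Set.mem_prod, Prod.exists]
  constructor
  · rintro ⟨y, hy, t, ht, rfl⟩
    refine ⟨t, ⟨_, sub_mem_facetDir T i hy⟩, ⟨ht, ?_⟩, ?_⟩
    · simpa [facetSet] using hy
    · simp only [AffineMap.lineMap_apply_module']
      rw [add_comm]
      congr 2
      abel
  · rintro ⟨t, w, ⟨ht, hw⟩, rfl⟩
    refine ⟨_, hw, t, ht, ?_⟩
    simp only [AffineMap.lineMap_apply_module']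
    rw [add_comm]
    congr 2
    abel

theorem euclideanHausdorffMeasure_facetDir :
    (μHE[d - 1] : Measure (facetDir T i)) = volume := by
  rw [← finrank_facetDir T i, InnerProductSpace.euclideanHausdorffMeasure_eq_volume]

theorem setIntegral_facet (f : EuclideanSpace ℝ (Fin d) → ℝ) :
    ∫ x in (T.faceOpposite i).closedInterior, f x ∂(μHE[d - 1]) =
      ∫ w in facetSet T i, f (T.points i + altitudeVec T i + w) := by
  have hiso := isometry_facetMap T i
  have hemb := hiso.isClosedEmbedding.measurableEmbedding
  have hsub : (T.faceOpposite i).closedInterior ⊆ Set.range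
      (fun w : facetDir T i => T.points i + altitudeVec T i + (w : EuclideanSpace ℝ (Fin d))) :=
    fun y hy => ⟨⟨_, sub_mem_facetDir T i hy⟩, by simp⟩
  rw [← Measure.restrict_restrict_of_subset hsub, ← hiso.map_euclideanHausdorffMeasure,
    hemb.setIntegral_map, euclideanHausdorffMeasure_facetDir]
  rfl

/-- The divergence theorem on `T` for the field `(x - v) q`, where `v` is a vertex. -/
theorem integral_radial (q : MvPolynomial (Fin d) ℝ) :
    ∫ x in T.closedInterior, val ((d : ℝ) • q + radial (T.points i) q) x =
      ‖altitudeVec T i‖ * ∫ x in (T.faceOpposite i).closedInterior, val q x ∂(μHE[d - 1]) := by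
  have hd : (d : ℝ) = ((d - 1 : ℕ) : ℝ) + 1 := by
    exact_mod_cast (Nat.sub_add_cancel (NeZero.pos d)).symm
  rw [setIntegral_facet, closedInterior_eq_cone T i,
    setIntegral_cone _ (finrank_facetDir_orthogonal T i) (altitudeVec_mem_orthogonal T i)
      (altitudeVec_ne_zero T i) _ (isCompact_facetSet T i) (continuous_val _)]
  simp_rw [finrank_facetDir, hd, integral_val_ray, ← add_assoc]

end Geometry

section Inequality

variable {d : ℕ} (T : Affine.Simplex ℝ (EuclideanSpace ℝ (Fin d)) d)

/-- `q` is `L²(T)`-orthogonal to all polynomials of degree less than `n`. -/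
def OrthLT (n : ℕ) (q : MvPolynomial (Fin d) ℝ) : Prop :=
  ∀ r ∈ polyLT d n, l2Form T q r = 0

theorem l2Form_apply (q r : MvPolynomial (Fin d) ℝ) :
    l2Form T q r = ∫ x in T.closedInterior, val q x * val r x := rfl

theorem l2Form_comm (q r : MvPolynomial (Fin d) ℝ) : l2Form T q r = l2Form T r q := by
  simp_rw [l2Form_apply, mul_comm]

theorem normSq_volume (q : MvPolynomial (Fin d) ℝ) :
    normSq volume T.closedInterior q = l2Form T q q := by
  simp_rw [l2Form_apply, normSq, sq]

theorem val_mul (q r : MvPolynomial (Fin d) ℝ) (x : EuclideanSpace ℝ (Fin d)) :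
    val (q * r) x = val q x * val r x := by simp [val]

theorem exists_sub_orthLT (n : ℕ) (q : MvPolynomial (Fin d) ℝ) :
    ∃ r ∈ polyLT d n, OrthLT T n (q - r) := by
  rcases n with _ | n
  · refine ⟨0, Submodule.zero_mem _, fun r hr => ?_⟩
    rw [polyLT_zero, Submodule.mem_bot] at hr
    simp [hr]
  · have h := isL2Proj_l2Proj T n q
    refine ⟨l2Proj T n q, ?_, ?_⟩
    · rw [polyLT_succ]; exact h.1
    · intro r hr
      rw [polyLT_succ] at hr
      exact h.2 r hr

theorem volume_closedInterior_pos : 0 < volume.real T.closedInterior :=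
  ENNReal.toReal_pos
    (Measure.measure_pos_of_nonempty_interior _ (interior_nonempty T)).ne'
    (isCompact_simplex T).measure_lt_top.ne

variable [NeZero d] (i : Fin (d + 1))

theorem measure_facet_lt_top :
    (μHE[d - 1]) (T.faceOpposite i).closedInterior < ⊤ := by
  have h : (T.faceOpposite i).closedInterior =
      (fun w : facetDir T i => T.points i + altitudeVec T i + w) '' facetSet T i := by
    rw [facetSet, Set.image_preimage_eq_iff.2]
    exact fun y hy => ⟨⟨_, sub_mem_facetDir T i hy⟩, by simp⟩
  rw [h, (isometry_facetMap T i).euclideanHausdorffMeasure_image,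
    euclideanHausdorffMeasure_facetDir]
  exact (isCompact_facetSet T i).measure_lt_top

theorem integrableOn_facet (q : MvPolynomial (Fin d) ℝ) :
    IntegrableOn (val q) (T.faceOpposite i).closedInterior (μHE[d - 1]) := by
  obtain ⟨C, hC⟩ := (T.faceOpposite i).isCompact_closedInterior.exists_bound_of_continuousOn
    (continuous_val q).continuousOn
  exact Measure.integrableOn_of_bounded (measure_facet_lt_top T i).ne
    (continuous_val q).aestronglyMeasurable
    (ae_restrict_of_forall_mem (T.faceOpposite i).isClosed_closedInterior.measurableSet hC)

theorem mul_volume_eq : (d : ℝ) * volume.real T.closedInterior =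
    ‖altitudeVec T i‖ * (μHE[d - 1]).real (T.faceOpposite i).closedInterior := by
  have h := integral_radial T i 1
  simpa [val, mul_comm] using h

/-- For a polynomial of degree at most `m` orthogonal to all polynomials of lower degree the trace
estimate is an identity. -/
theorem normSq_facet_eq {m : ℕ} {q : MvPolynomial (Fin d) ℝ} (hq : q ∈ polyLT d (m + 1))
    (ho : OrthLT T m q) :
    normSq (μHE[d - 1]) (T.faceOpposite i).closedInterior q =
      (2 * m + d) / d * ((μHE[d - 1]).real (T.faceOpposite i).closedInterior /
        volume.real T.closedInterior) * normSq volume T.closedInterior q := by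
  have h := integral_radial T i (q * q)
  have hE : l2Form T q (radial (T.points i) q) = m * l2Form T q q := by
    have h0 := ho _ (radial_sub_smul_mem (T.points i) hq)
    rw [map_sub, map_smul, sub_eq_zero] at h0
    exact h0
  have hL : ∫ x in T.closedInterior, val ((d : ℝ) • (q * q) + radial (T.points i) (q * q)) x =
      (2 * m + d) * l2Form T q q := by
    have hv : (d : ℝ) • (q * q) + radial (T.points i) (q * q) =
        q * ((d : ℝ) • q + (2 : ℝ) • radial (T.points i) q) := by
      rw [Derivation.leibniz, smul_eq_mul, ← two_smul ℝ, mul_add, mul_smul_comm, mul_smul_comm]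
    rw [hv]
    simp_rw [val_mul]
    rw [← l2Form_apply, map_add, map_smul, map_smul, hE]
    simp only [smul_eq_mul]
    ring
  have hF : ∫ x in (T.faceOpposite i).closedInterior, val (q * q) x ∂(μHE[d - 1]) =
      normSq (μHE[d - 1]) (T.faceOpposite i).closedInterior q := by
    simp_rw [normSq, val_mul, sq]
  rw [hL, hF] at h
  have hV := volume_closedInterior_pos T
  have hd : (0 : ℝ) < d := by exact_mod_cast NeZero.pos d
  have hm := mul_volume_eq T i
  have hh : 0 < ‖altitudeVec T i‖ := norm_pos_iff.2 (altitudeVec_ne_zero T i)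
  rw [normSq_volume, div_mul_div_comm, div_mul_eq_mul_div, eq_div_iff (by positivity), hm]
  linear_combination -(μHE[d - 1]).real (T.faceOpposite i).closedInterior * h

/-- The inverse trace inequality for polynomials of degree less than `M` orthogonal to all
polynomials of degree less than `N`. -/
theorem normSq_facet_le {N M : ℕ} (hNM : N ≤ M) {q : MvPolynomial (Fin d) ℝ}
    (hq : q ∈ polyLT d M) (ho : OrthLT T N q) :
    normSq (μHE[d - 1]) (T.faceOpposite i).closedInterior q ≤
      ((M : ℝ) - N) * (M + N + d - 1) / d *
        ((μHE[d - 1]).real (T.faceOpposite i).closedInterior / volume.real T.closedInterior) *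
        normSq volume T.closedInterior q := by
  induction M, hNM using Nat.le_induction generalizing q with
  | base =>
    have : q = 0 := eq_zero_of_integral_sq T q (ho q hq)
    subst this
    simp [normSq, val]
  | succ M hNM ih =>
    have hd : (0 : ℝ) < d := by exact_mod_cast NeZero.pos d
    rcases hNM.eq_or_lt with rfl | hlt
    · rw [normSq_facet_eq T i hq ho]
      refine le_of_eq ?_
      push_cast
      congr 3
      ring
    obtain ⟨r, hr, hor⟩ := exists_sub_orthLT T M q
    set s := q - r with hs
    have hqrs : q = r + s := by rw [hs]; ring
    have hsq : s ∈ polyLT d (M + 1) := Submodule.sub_mem _ hq (polyLT_mono M.le_succ hr)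
    have hrN : OrthLT T N r := by
      intro p hp
      have h1 := ho p hp
      have h2 := hor p (polyLT_mono hNM hp)
      rw [hqrs, map_add, LinearMap.add_apply, h2, add_zero] at h1
      exact h1
    have hr1 := ih hr hrN
    have hs1 := normSq_facet_eq T i hsq hor
    set ρ := (μHE[d - 1]).real (T.faceOpposite i).closedInterior / volume.real T.closedInterior
      with hρ
    have hpyth : normSq volume T.closedInterior q =
        normSq volume T.closedInterior r + normSq volume T.closedInterior s := by
      simp_rw [normSq_volume]
      rw [hqrs, map_add, map_add, LinearMap.add_apply, LinearMap.add_apply, hor r hr,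
        l2Form_comm T r s, hor r hr]
      ring
    set a : ℝ := ((M : ℝ) - N) * (M + N + d - 1) / d with ha
    set b : ℝ := (2 * M + d) / d with hb
    have hNM' : (N : ℝ) + 1 ≤ M := by exact_mod_cast hlt
    have hN0 : (0 : ℝ) ≤ N := N.cast_nonneg
    have ha0 : 0 < a := by
      refine div_pos (mul_pos ?_ ?_) hd <;> linarith
    have hb0 : 0 < b := div_pos (by linarith) hd
    have hab : ((M + 1 : ℕ) - N : ℝ) * ((M + 1 : ℕ) + N + d - 1) / d = a + b := by
      rw [ha, hb, ← add_div]
      push_cast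
      ring
    have hCS : normSq (μHE[d - 1]) (T.faceOpposite i).closedInterior q ≤
        (a + b) / a * normSq (μHE[d - 1]) (T.faceOpposite i).closedInterior r +
        (a + b) / b * normSq (μHE[d - 1]) (T.faceOpposite i).closedInterior s := by
      have hint : ∀ p : MvPolynomial (Fin d) ℝ, IntegrableOn (fun x => val p x ^ 2)
          (T.faceOpposite i).closedInterior (μHE[d - 1]) := by
        intro p
        have h := integrableOn_facet T i (p * p)
        simp only [sq]
        exact h.congr_fun (fun x _ => val_mul p p x)
          (T.faceOpposite i).isClosed_closedInterior.measurableSet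
      unfold normSq
      rw [← integral_const_mul, ← integral_const_mul,
        ← integral_add ((hint r).const_mul _) ((hint s).const_mul _)]
      refine integral_mono (hint q) (((hint r).const_mul _).add ((hint s).const_mul _)) fun x => ?_
      have hx : val q x = val r x + val s x := by simp [hqrs, val]
      simp only [hx]
      have : (a + b) / a * val r x ^ 2 + (a + b) / b * val s x ^ 2 - (val r x + val s x) ^ 2 =
          (b * val r x - a * val s x) ^ 2 / (a * b) := by
        field_simp
        ring
      have h0 : 0 ≤ (b * val r x - a * val s x) ^ 2 / (a * b) := by positivity
      linarith
    rw [hab, hpyth]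
    refine hCS.trans ?_
    rw [hs1]
    calc _ ≤ (a + b) / a * (a * ρ * normSq volume T.closedInterior r) +
          (a + b) / b * (b * ρ * normSq volume T.closedInterior s) := by gcongr
      _ = _ := by field_simp

end Inequality

end InverseTrace

theorem theorem1 {d : ℕ} [NeZero d]
    (T : Affine.Simplex ℝ (EuclideanSpace ℝ (Fin d)) d) (i : Fin (d + 1))
    (p : ℕ) (n : ℤ) (hn : -1 ≤ n) (hnp : n ≤ p)
    (ξ : MvPolynomial (Fin d) ℝ) (hξ : ξ ∈ InverseTrace.Poly d p) :
    InverseTrace.normSq (μHE[d - 1])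
        (T.faceOpposite i).closedInterior (ξ - InverseTrace.projT T n ξ) ≤
      ((p : ℝ) - n) * (p + n + 1 + d) / d *
        ((μHE[d - 1]).real (T.faceOpposite i).closedInterior /
          volume.real T.closedInterior) *
        InverseTrace.normSq volume T.closedInterior (ξ - InverseTrace.projT T n ξ) := by
  rw [← InverseTrace.polyLT_succ] at hξ
  obtain ⟨N, rfl⟩ : ∃ N : ℕ, n = (N : ℤ) - 1 := ⟨(n + 1).toNat, by omega⟩
  have hN : N ≤ p + 1 := by omega
  have hθ : ξ - InverseTrace.projT T ((N : ℤ) - 1) ξ ∈ InverseTrace.polyLT d (p + 1) ∧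
      InverseTrace.OrthLT T N (ξ - InverseTrace.projT T ((N : ℤ) - 1) ξ) := by
    rcases N with _ | m
    · have h0 : InverseTrace.projT T (((0 : ℕ) : ℤ) - 1) ξ = 0 := rfl
      rw [h0, sub_zero]
      refine ⟨hξ, fun r hr => ?_⟩
      rw [InverseTrace.polyLT_zero, Submodule.mem_bot] at hr
      simp [hr]
    · have h0 : InverseTrace.projT T (((m + 1 : ℕ) : ℤ) - 1) ξ = InverseTrace.l2Proj T m ξ := by
        rw [Nat.cast_succ, add_sub_cancel_right]
        rfl
      have h := InverseTrace.isL2Proj_l2Proj T m ξ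
      rw [h0]
      refine ⟨Submodule.sub_mem _ hξ (InverseTrace.polyLT_mono hN ?_), fun r hr => ?_⟩
      · rw [InverseTrace.polyLT_succ]
        exact h.1
      · rw [InverseTrace.polyLT_succ] at hr
        exact h.2 r hr
  convert! InverseTrace.normSq_facet_le T i hN hθ.1 hθ.2 using 4
  push_cast
  ring
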